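/- For a set $X\subseteq\mathbb R$, a \emph{gap} of $X$ is a connected component of $\mathbb R\setminus X$ (the unbounded ones included), and an \emph{interval} of $X$ is a connected component of $X$ with more than one point. An \emph{$L$-Cantorval} is a nonempty compact set $X\subseteq\mathbb R$ such that - whenever a gap of $X$ has a right endpoint $b\in\mathbb R$, some interval of $X$ has $b$ as its left endpoint, and - whenever a gap of $X$ has a left endpoint $a\in\mathbb R$, for every $\varepsilon>0$ infinitely many intervals and infinitely many gaps of $X$ are contained in $(a-\varepsilon,a)$. The set $\mathcal C_X$ of connected components of $X$ carries the topology generated by the sets $\{C\in\mathcal C_X: C\subseteq V\}$ with $V$ clopen in $X$. An endpoint $e$ of an interval $I$ of $X$ is \emph{free} if $e$ belongs to the interior of $I$ relative to $X$. Let $\mathcal Z_X\subseteq\mathcal C_X$, with the subspace topology, be the set of those components with more than one point that have no free endpoint. \textbf{Theorem.} (1) There are continuum many pairwise non-homeomorphic $L$-Cantorvals. More precisely, there is a family $\mathcal S$ of $L$-Cantorvals of cardinality $2^{\aleph_0}$ such that for distinct $X,Y\in\mathcal S$ the spaces $X$ and $Y$ are not homeomorphic and the spaces $\mathcal Z_X$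 and $\mathcal Z_Y$ are not homeomorphic; moreover each $\mathcal Z_X$, $X\in\mathcal S$, is a countable scattered metrizable space (scattered: every nonempty subset has an isolated point). (2) If $X$ and $Y$ are homeomorphic $L$-Cantorvals, then $\mathcal Z_X$ and $\mathcal Z_Y$ are homeomorphic. (3) If $\alpha$ is a countable ordinal and $A\subseteq\alpha$, then there is an $L$-Cantorval $X$ such that $\mathcal Z_X$ is homeomorphic to $A$ with the topology inherited from the order topology of $\alpha$. -/

import Mathlib

/-- An `X`-gap: a connected component of the complement of `X` in the real line
(the two unbounded components are included). -/
def IsGap (X U : Set ℝ) : Prop :=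
  ∃ x ∈ Xᶜ, U = connectedComponentIn Xᶜ x

/-- An `X`-interval: a non-trivial (more than one point) connected component of `X`. -/
def IsXInterval (X J : Set ℝ) : Prop :=
  J.Nontrivial ∧ ∃ x ∈ X, J = connectedComponentIn X x

/-- An `L`-Cantorval: a nonempty compact set of reals such that every gap has an interval adjacent
to its right and is accumulated on its left by infinitely many intervals and gaps.
The first condition concerns the gaps that have a right endpoint (all but the rightmost one), the
second condition concerns the gaps that have a left endpoint (all but the leftmost one). -/
structure IsLCantorval (X : Set ℝ) : Prop where
  nonempty : X.Nonempty
  isCompact : IsCompact X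
  adjacent_right : ∀ U, IsGap X U → ∀ b, IsLUB U b → ∃ J, IsXInterval X J ∧ IsLeast J b
  accumulated_left : ∀ U, IsGap X U → ∀ a, IsGLB U a → ∀ ε : ℝ, 0 < ε →
    {J | IsXInterval X J ∧ J ⊆ Set.Ioo (a - ε) a}.Infinite ∧
    {V | IsGap X V ∧ V ⊆ Set.Ioo (a - ε) a}.Infinite

/-- The family of all connected components of a topological space. -/
def ComponentSpace (X : Type*) [TopologicalSpace X] : Type _ :=
  {C : Set X // ∃ x, C = connectedComponent x}

/-- The topology on the family of components generated by the sets
`V* = {C | C ⊆ V}`, with `V` clopen. -/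
instance ComponentSpace.instTopologicalSpace (X : Type*) [TopologicalSpace X] :
    TopologicalSpace (ComponentSpace X) :=
  TopologicalSpace.generateFrom
    {W | ∃ V : Set X, IsClopen V ∧ W = {C : ComponentSpace X | C.1 ⊆ V}}

/-- `e` is a free endpoint of the component `C` of `X`: `C` is non-trivial, `e` is one of its two
endpoints, and `e` lies in the interior of `C` relative to `X`. -/
def IsFreeEndpoint {X : Set ℝ} (C : Set X) (e : X) : Prop :=
  C.Nontrivial ∧ (IsLeast C e ∨ IsGreatest C e) ∧ e ∈ interior C

/-- The non-trivial components of `X` without free endpoints, as a subset of the space of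
components of `X`; it carries the subspace topology. -/
def nonFreeComponents (X : Set ℝ) : Set (ComponentSpace X) :=
  {C | C.1.Nontrivial ∧ ∀ e, ¬ IsFreeEndpoint C.1 e}

/-- A scattered space: every nonempty subset has a point isolated in it. -/
def IsScatteredSpace (T : Type*) [TopologicalSpace T] : Prop :=
  ∀ B : Set T, B.Nonempty → ∃ x ∈ B, ∃ U : Set T, IsOpen U ∧ U ∩ B = {x}

/-! Everything rests on realising an arbitrary countable metrizable space as `nonFreeComponents X`.
Such a space is zero-dimensional, hence homeomorphic to a set `Z` of irrationals in `(0, 1)`. Take a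
continuous monotone map of the line whose nondegenerate fibres lie over `0`, the rationals of `(0,
1)` and `Z`, and delete from the preimage of `[0, 1]` the open left half of each rational fibre. The
deleted halves are the bounded gaps; the right half that remains is the interval adjacent to each
gap, and density of the rationals gives the accumulation on the left. Intervals over `0` or a
rational follow a gap, so their left endpoints are free. Rationals approach a point of `Z` from both
sides, so the intervals over `Z` have no free endpoint, and they form a copy of `Z`
(`nonempty_homeomorph`). This gives (3).

For (2), endpoints of a component are its non-cut points, so homeomorphisms respect free endpoints.

For (1) it remains to find continuum many countable scattered metrizable spaces. In `FinsetRankSpace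
R` points near `(n, s)` have the form `(n, t)` with `t ⊇ s`, so the defect `n - |s|` acts as a rank
with values in `R`. Let consecutive values of `R` differ by `1` or `2` as `σ` dictates. A skipped
value leaves limit points missing, which destroys a local compactness property of the
Cantor-Bendixson levels; so `σ` can be recovered from the topology (`hasCompactTrace_iff`). -/

open Set Filter Topology MeasureTheory in
/-- A monotone function which is continuous exactly off a given countable nonempty set. -/
theorem exists_monotone_bounded_discontinuous_on {E : Set ℝ} (hE : E.Countable)
    (hne : E.Nonempty) :
    ∃ f : ℝ → ℝ, Monotone f ∧ (∀ t, 0 ≤ f t) ∧ (∀ t, f t ≤ 1) ∧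
      ∀ t, Function.leftLim f t < Function.rightLim f t ↔ t ∈ E := by
  have := hE.to_subtype
  obtain ⟨w, hw, hsum⟩ := ENNReal.exists_pos_sum_of_countable' one_ne_zero E
  classical
  let v : ℝ → ENNReal := fun t => if h : t ∈ E then w ⟨t, h⟩ else 0
  have hv : tsum v = ∑' e : E, w e := by
    rw [← tsum_subtype_eq_of_support_subset (s := E)]
    · refine tsum_congr fun e => ?_
      simp
    · intro t ht
      by_contra h
      exact ht (by simp [h])
  have hv0 : ∀ t, v t ≠ 0 ↔ t ∈ E := by
    intro t
    by_cases h : t ∈ E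
    · simp [v, h, (hw ⟨t, h⟩).ne']
    · simp [v, h]
  have h0 : tsum v ≠ 0 := by
    obtain ⟨t, ht⟩ := hne
    intro h
    exact (hv0 t).2 ht (ENNReal.tsum_eq_zero.1 h t)
  have htop : tsum v ≠ ⊤ := by
    rw [hv]
    exact (hsum.trans ENNReal.one_lt_top).ne
  -- The atoms of this probability measure are exactly the points of `E`, and a distribution
  -- function jumps exactly at the atoms.
  let P := PMF.normalize v h0 htop
  have hP : ∀ t, P.toMeasure {t} ≠ 0 ↔ t ∈ E := by
    intro t
    rw [PMF.toMeasure_apply_singleton _ _ (measurableSet_singleton t), ← hv0,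
      ← PMF.mem_support_normalize_iff h0 htop]
    rfl
  refine ⟨ProbabilityTheory.cdf P.toMeasure, ProbabilityTheory.monotone_cdf _,
    ProbabilityTheory.cdf_nonneg _, ProbabilityTheory.cdf_le_one _, fun t => ?_⟩
  rw [StieltjesFunction.rightLim_eq, ← hP t]
  have := StieltjesFunction.measure_singleton (ProbabilityTheory.cdf P.toMeasure) t
  rw [ProbabilityTheory.measure_cdf] at this
  rw [this, Ne, ENNReal.ofReal_eq_zero, not_le, sub_pos]

open Set Filter Topology in
/-- A monotone continuous map of the line whose fibres over a given countable nonempty set are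
nondegenerate intervals, all other fibres being points. -/
theorem exists_monotone_fiber_Icc {E : Set ℝ} (hE : E.Countable) (hne : E.Nonempty) :
    ∃ H p q : ℝ → ℝ, Continuous H ∧ Monotone H ∧ (∀ t, p t ≤ q t) ∧
      (∀ t y, H y = t ↔ p t ≤ y ∧ y ≤ q t) ∧ ∀ t, p t < q t ↔ t ∈ E := by
  obtain ⟨f, hmono, h0, h1, hf⟩ := exists_monotone_bounded_discontinuous_on hE hne
  let S : ℝ → Set ℝ := fun y => {t | t + f t ≤ y}
  have hSne : ∀ y, (S y).Nonempty := fun y => ⟨y - 1, by have := h1 (y - 1); simp [S]; linarith⟩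
  have hSbdd : ∀ y, BddAbove (S y) := fun y => ⟨y, fun t ht => by
    have := h0 t; simp only [S, mem_ofPred_eq] at ht; linarith⟩
  -- This is the generalised inverse of the strictly increasing `t + f t`: each jump of `f` becomes
  -- a flat piece of `H`, bounded by the one-sided limits `p` and `q`.
  let H : ℝ → ℝ := fun y => sSup (S y)
  have hle : ∀ {t y}, t + f t ≤ y → t ≤ H y := fun h => le_csSup (hSbdd _) h
  have hge : ∀ {t y}, y < t + f t → H y ≤ t := fun {t y} h => csSup_le (hSne _) fun s hs => by
    simp only [S, mem_ofPred_eq] at hs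
    by_contra hst
    have := hmono (not_le.1 hst).le
    linarith
  let p : ℝ → ℝ := fun t => t + Function.leftLim f t
  let q : ℝ → ℝ := fun t => t + Function.rightLim f t
  have hfib : ∀ t y, H y = t ↔ p t ≤ y ∧ y ≤ q t := by
    intro t y
    constructor
    · rintro rfl
      constructor
      · by_contra! hlt
        have h := (continuous_id.continuousWithinAt (s := Iio (H y)) (x := H y)).tendsto.add
          (hmono.tendsto_leftLim (H y))
        obtain ⟨s, hs, hs'⟩ := ((h.eventually (lt_mem_nhds hlt)).and self_mem_nhdsWithin).exists
        exact absurd (hge hs) (not_le.2 hs')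
      · by_contra! hlt
        have h := (continuous_id.continuousWithinAt (s := Ioi (H y)) (x := H y)).tendsto.add
          (hmono.tendsto_rightLim (H y))
        obtain ⟨s, hs, hs'⟩ := ((h.eventually (gt_mem_nhds hlt)).and self_mem_nhdsWithin).exists
        exact absurd (hle (le_of_lt hs)) (not_le.2 hs')
    · rintro ⟨hp, hq⟩
      apply le_antisymm
      · refine le_of_forall_gt_imp_ge_of_dense fun s hs => hge ?_
        have := hmono.rightLim_le hs
        simp only [q] at hq
        linarith
      · refine le_of_forall_lt_imp_le_of_dense fun s hs => hle ?_
        have := hmono.le_leftLim hs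
        simp only [p] at hp
        linarith
  have hpq : ∀ t, p t ≤ q t := fun t => by
    have := hmono.leftLim_le_rightLim (le_refl t)
    simp only [p, q]
    linarith
  have hmonoH : Monotone H := fun a b hab =>
    csSup_le_csSup (hSbdd b) (hSne a) fun t ht => le_trans ht hab
  refine ⟨H, p, q, hmonoH.continuous_of_surjective
    fun t => ⟨p t, (hfib t _).2 ⟨le_rfl, hpq t⟩⟩, hmonoH, hpq, hfib, fun t => ?_⟩
  rw [← hf t]
  simp only [p, q]
  exact add_lt_add_iff_left t

/-! ### Embedding countable metrizable spaces in the irrationals -/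

open Set Filter Topology TopologicalSpace in
/-- A countable metrizable space has a sequence of clopen sets which is a base. -/
theorem exists_clopen_base_of_countable (W : Type*) [TopologicalSpace W] [Countable W]
    [MetrizableSpace W] :
    ∃ B : ℕ → Set W, (∀ n, IsClopen (B n)) ∧
      ∀ x, ∀ U ∈ 𝓝 x, ∃ n, x ∈ B n ∧ B n ⊆ U := by
  rcases isEmpty_or_nonempty W with hW | hW
  · exact ⟨fun _ => ∅, fun _ => isClopen_empty, fun x => hW.elim x⟩
  let := metrizableSpaceMetric W
  -- Only countably many distances occur, so some radius has an empty sphere; its open ball equals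
  -- the closed ball and is clopen.
  have hr : ∀ (i : W × ℕ), ∃ r ∈ Ioo (0 : ℝ) (1 / ((i.2 : ℝ) + 1)), ∀ y, dist y i.1 ≠ r := by
    intro i
    have hc : (range fun y => dist y i.1).Countable := countable_range _
    obtain ⟨r, hr, hr'⟩ := (hc.dense_compl ℝ).inter_open_nonempty _ isOpen_Ioo
      (nonempty_Ioo.2 (Nat.one_div_pos_of_nat (α := ℝ) (n := i.2)))
    exact ⟨r, hr, fun y hy => hr' ⟨y, hy⟩⟩
  choose r hr hr' using hr
  obtain ⟨e, he⟩ := exists_surjective_nat (W × ℕ)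
  refine ⟨fun n => Metric.ball (e n).1 (r (e n)), fun n => ⟨?_, Metric.isOpen_ball⟩, ?_⟩
  · have : Metric.ball (e n).1 (r (e n)) = Metric.closedBall (e n).1 (r (e n)) := by
      ext y
      simp only [Metric.mem_ball, Metric.mem_closedBall]
      exact ⟨le_of_lt, fun h => lt_of_le_of_ne h (hr' _ y)⟩
    simp only [this]
    exact Metric.isClosed_closedBall
  · intro x U hU
    obtain ⟨ε, hε, hεU⟩ := Metric.mem_nhds_iff.1 hU
    obtain ⟨k, hk⟩ := exists_nat_one_div_lt hε
    obtain ⟨n, hn⟩ := he (x, k)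
    refine ⟨n, ?_, ?_⟩
    · simp only [hn]
      exact Metric.mem_ball_self (hr (x, k)).1
    · simp only [hn]
      exact (Metric.ball_subset_ball ((hr (x, k)).2.trans hk).le).trans hεU

open Set Filter Topology TopologicalSpace in
/-- A countable metrizable space embeds into the Cantor space. -/
theorem exists_isEmbedding_nat_bool (W : Type*) [TopologicalSpace W] [Countable W]
    [MetrizableSpace W] : ∃ F : W → ℕ → Bool, IsEmbedding F := by
  obtain ⟨B, hB, hbase⟩ := exists_clopen_base_of_countable W
  have hcont : Continuous fun (x : W) (n : ℕ) => (B n).boolIndicator x :=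
    continuous_pi fun n => (continuous_boolIndicator_iff_isClopen _).2 (hB n)
  refine ⟨fun x n => (B n).boolIndicator x, ⟨isInducing_iff_nhds.2 fun x => ?_, ?_⟩⟩
  · refine le_antisymm hcont.continuousAt.le_comap fun U hU => ?_
    obtain ⟨n, hn, hnU⟩ := hbase x U hU
    refine mem_comap.2 ⟨{g | g n = true}, ?_, fun y hy => hnU ?_⟩
    · refine IsOpen.mem_nhds ?_ ((mem_iff_boolIndicator _ _).1 hn)
      exact (isOpen_discrete ({true} : Set Bool)).preimage
        (continuous_apply n : Continuous fun g : ℕ → Bool => g n)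
    · exact (mem_iff_boolIndicator _ _).2 hy
  · intro x y hxy
    by_contra hne
    obtain ⟨n, hn, hnU⟩ := hbase x {y}ᶜ (isOpen_compl_singleton.mem_nhds hne)
    have h := (mem_iff_boolIndicator _ _).1 hn
    have h' : (B n).boolIndicator x = (B n).boolIndicator y := congrFun hxy n
    rw [h'] at h
    exact hnU ((mem_iff_boolIndicator _ _).2 h) rfl

open Set Filter Topology TopologicalSpace in
/-- A countable metrizable space embeds into the irrationals of the unit interval. -/
theorem exists_isEmbedding_irrational (W : Type*) [TopologicalSpace W] [Countable W]
    [MetrizableSpace W] :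
    ∃ g : W → ℝ, IsEmbedding g ∧ ∀ w, g w ∈ Ioo (0 : ℝ) 1 ∧ Irrational (g w) := by
  obtain ⟨F, hF⟩ := exists_isEmbedding_nat_bool W
  let g : W → ℝ := fun w => (cantorSetHomeomorphNatToBool.symm (F w) : ℝ)
  have hg : IsEmbedding g :=
    IsEmbedding.subtypeVal.comp (cantorSetHomeomorphNatToBool.symm.isEmbedding.comp hF)
  have hg01 : ∀ w, g w ∈ Icc (0 : ℝ) 1 := fun w => cantorSet_subset_unitInterval (Subtype.prop _)
  -- A shift `c` outside this set makes every `g w + c` irrational. These values lie in `(0, 2)`,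
  -- and division by `3` brings them into `(0, 1)`.
  have hc : (range fun i : ℚ × W => (i.1 : ℝ) - g i.2).Countable := countable_range _
  obtain ⟨c, hc01, hc⟩ := (hc.dense_compl ℝ).inter_open_nonempty _ isOpen_Ioo
    (nonempty_Ioo.2 (zero_lt_one (α := ℝ)))
  refine ⟨fun w => (g w + c) / (3 : ℕ), ?_, fun w => ⟨?_, ?_⟩⟩
  · refine IsEmbedding.comp (g := fun x : ℝ => (x + c) / (3 : ℕ)) ?_ hg
    simp only [div_eq_mul_inv]
    exact ((Homeomorph.addRight c).trans
      (Homeomorph.mulRight₀ ((3 : ℕ) : ℝ)⁻¹ (by norm_num))).isEmbedding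
  · have := hg01 w
    simp only [mem_Icc, mem_Ioo] at *
    push_cast
    constructor <;> linarith
  · have : Irrational (g w + c) := by
      rintro ⟨r, hr⟩
      exact hc ⟨(r, w), by simp [hr]⟩
    exact this.div_natCast (by norm_num)

/-! ### The L-Cantorval of an interval collapse -/

open Set in
/-- A convex piece of `F` all of whose points are separated by the complement of `F` from the
other points of `F` is a component of `F`. -/
theorem connectedComponentIn_eq_of_separated {F I : Set ℝ} {x : ℝ} (hI : I.OrdConnected)
    (hx : x ∈ I) (hIF : I ⊆ F) (hsep : ∀ y ∈ F, y ∉ I → ∃ z ∈ uIcc x y, z ∉ F) :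
    connectedComponentIn F x = I := by
  apply Subset.antisymm
  · intro y hy
    by_contra hyI
    obtain ⟨z, hz, hzF⟩ := hsep y (connectedComponentIn_subset F x hy) hyI
    have hc : (connectedComponentIn F x).OrdConnected :=
      isPreconnected_iff_ordConnected.1 isPreconnected_connectedComponentIn
    exact hzF (connectedComponentIn_subset F x
      (hc.uIcc_subset (mem_connectedComponentIn (hIF hx)) hy hz))
  · exact (isPreconnected_iff_ordConnected.2 hI).subset_connectedComponentIn hx hIF

/-- The rational points of the open unit interval. -/
def ratUnit : Set ℝ := {t | t ∈ Set.Ioo (0 : ℝ) 1 ∧ t ∈ Set.range ((↑) : ℚ → ℝ)}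

theorem exists_ratUnit_between {s t : ℝ} (hs : 0 ≤ s) (ht : t ≤ 1) (hst : s < t) :
    ∃ d ∈ ratUnit, s < d ∧ d < t := by
  obtain ⟨r, h1, h2⟩ := exists_rat_btwn hst
  exact ⟨r, ⟨⟨hs.trans_lt h1, h2.trans_le ht⟩, r, rfl⟩, h1, h2⟩

theorem infinite_ratUnit_between {s t : ℝ} (hs : 0 ≤ s) (ht : t ≤ 1) (hst : s < t) :
    {d | d ∈ ratUnit ∧ s < d ∧ d < t}.Infinite := by
  obtain ⟨r, h1, h2⟩ := exists_rat_btwn hst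
  obtain ⟨r', h3, h4⟩ := exists_rat_btwn h2
  refine Set.infinite_of_injOn_mapsTo (s := Set.Ioo r r') (f := ((↑) : ℚ → ℝ))
    Rat.cast_injective.injOn ?_ (Set.Ioo_infinite (by exact_mod_cast h3))
  rintro x ⟨hx, hx'⟩
  have h5 : s < x := h1.trans (by exact_mod_cast hx)
  have h6 : (x : ℝ) < t := lt_trans (by exact_mod_cast hx') h4
  exact ⟨⟨⟨hs.trans_lt h5, h6.trans_le ht⟩, x, rfl⟩, h5, h6⟩

/-- A monotone map of the line which collapses intervals exactly to the rationals of `(0, 1)`, to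
`0`, and to the points of a set `Z` of irrationals of `(0, 1)`. -/
structure IntervalCollapse (Z : Set ℝ) where
  toFun : ℝ → ℝ
  left : ℝ → ℝ
  right : ℝ → ℝ
  continuous : Continuous toFun
  monotone : Monotone toFun
  left_le_right : ∀ t, left t ≤ right t
  fiber : ∀ t y, toFun y = t ↔ left t ≤ y ∧ y ≤ right t
  left_lt_right : ∀ t, left t < right t ↔ t = 0 ∨ t ∈ ratUnit ∨ t ∈ Z
  mem_Ioo : ∀ t ∈ Z, t ∈ Set.Ioo (0 : ℝ) 1
  irrational : ∀ t ∈ Z, Irrational t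

theorem exists_intervalCollapse {Z : Set ℝ} (hZ : Z.Countable)
    (hZ' : ∀ t ∈ Z, t ∈ Set.Ioo (0 : ℝ) 1 ∧ Irrational t) : Nonempty (IntervalCollapse Z) := by
  have hD : ratUnit.Countable := (Set.countable_range ((↑) : ℚ → ℝ)).mono fun t ht => ht.2
  obtain ⟨H, p, q, h1, h2, h3, h4, h5⟩ := exists_monotone_fiber_Icc
    (E := insert 0 (ratUnit ∪ Z)) ((hD.union hZ).insert 0) ⟨0, by simp⟩
  exact ⟨⟨H, p, q, h1, h2, h3, h4, h5, fun t ht => (hZ' t ht).1, fun t ht => (hZ' t ht).2⟩⟩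

namespace IntervalCollapse

open Set Filter Topology

variable {Z : Set ℝ} (K : IntervalCollapse Z)

theorem toFun_left (t : ℝ) : K.toFun (K.left t) = t :=
  (K.fiber _ _).2 ⟨le_rfl, K.left_le_right t⟩

theorem toFun_right (t : ℝ) : K.toFun (K.right t) = t :=
  (K.fiber _ _).2 ⟨K.left_le_right t, le_rfl⟩

theorem lt_left_iff {t y : ℝ} : y < K.left t ↔ K.toFun y < t := by
  constructor
  · intro h
    refine lt_of_le_of_ne ((K.monotone h.le).trans_eq (K.toFun_left t)) fun he => ?_
    exact absurd ((K.fiber _ _).1 he).1 (not_le.2 h)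
  · intro h
    by_contra! hn
    have := K.monotone hn
    rw [K.toFun_left] at this
    exact absurd h (not_lt.2 this)

theorem right_lt_iff {t y : ℝ} : K.right t < y ↔ t < K.toFun y := by
  constructor
  · intro h
    refine lt_of_le_of_ne ((K.toFun_right t).symm.trans_le (K.monotone h.le)) fun he => ?_
    exact absurd ((K.fiber _ _).1 he.symm).2 (not_le.2 h)
  · intro h
    by_contra! hn
    have := K.monotone hn
    rw [K.toFun_right] at this
    exact absurd h (not_lt.2 this)

theorem right_lt_left {s t : ℝ} (h : s < t) : K.right s < K.left t := by
  rwa [K.lt_left_iff, K.toFun_right]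

/-- The midpoint of a fibre. -/
noncomputable def mid (t : ℝ) : ℝ := (K.left t + K.right t) / 2

/-- The point a quarter into a fibre. -/
noncomputable def quarter (t : ℝ) : ℝ := (K.left t + K.mid t) / 2

variable {K}

theorem zero_notMem_ratUnit : (0 : ℝ) ∉ ratUnit := fun h => lt_irrefl _ h.1.1

theorem left_lt_quarter {d : ℝ} (hd : d ∈ ratUnit) : K.left d < K.quarter d := by
  have := (K.left_lt_right d).2 (Or.inr (Or.inl hd))
  simp only [quarter, mid]
  linarith

theorem quarter_lt_mid {d : ℝ} (hd : d ∈ ratUnit) : K.quarter d < K.mid d := by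
  have := (K.left_lt_right d).2 (Or.inr (Or.inl hd))
  simp only [quarter, mid]
  linarith

theorem mid_lt_right {d : ℝ} (hd : d ∈ ratUnit) : K.mid d < K.right d := by
  have := (K.left_lt_right d).2 (Or.inr (Or.inl hd))
  simp only [mid]
  linarith

theorem left_lt_mid {d : ℝ} (hd : d ∈ ratUnit) : K.left d < K.mid d :=
  (left_lt_quarter hd).trans (quarter_lt_mid hd)

theorem toFun_quarter {d : ℝ} (hd : d ∈ ratUnit) : K.toFun (K.quarter d) = d :=
  (K.fiber _ _).2 ⟨(left_lt_quarter hd).le, ((quarter_lt_mid hd).trans (mid_lt_right hd)).le⟩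

variable (K)

/-- The preimage of the unit interval, with the left half of every fibre over a rational point of
`(0, 1)` removed. -/
def carrier : Set ℝ :=
  {y | K.toFun y ∈ Icc 0 1} \ ⋃ d ∈ ratUnit, Ioo (K.left d) (K.mid d)

variable {K}

theorem mem_carrier_iff {y : ℝ} : y ∈ K.carrier ↔
    K.toFun y ∈ Icc 0 1 ∧ ∀ d ∈ ratUnit, y ∉ Ioo (K.left d) (K.mid d) := by
  simp only [carrier, Set.mem_sdiff, mem_ofPred_eq, mem_iUnion, not_exists]

theorem toFun_eq_of_mem_Ioo {d y : ℝ} (hd : d ∈ ratUnit) (hy : y ∈ Ioo (K.left d) (K.mid d)) :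
    K.toFun y = d :=
  (K.fiber _ _).2 ⟨hy.1.le, (hy.2.trans (mid_lt_right hd)).le⟩

theorem quarter_notMem {d : ℝ} (hd : d ∈ ratUnit) : K.quarter d ∉ K.carrier := fun h =>
  (mem_carrier_iff.1 h).2 d hd ⟨left_lt_quarter hd, quarter_lt_mid hd⟩

theorem mem_carrier_of_toFun_eq {t y : ℝ} (ht : t ∈ Icc (0 : ℝ) 1) (hy : K.toFun y = t)
    (h : y ∉ Ioo (K.left t) (K.mid t)) : y ∈ K.carrier := by
  refine mem_carrier_iff.2 ⟨hy ▸ ht, fun d hd hyd => ?_⟩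
  have := toFun_eq_of_mem_Ioo hd hyd
  rw [← this, hy] at hyd
  exact h hyd

theorem left_mem {t : ℝ} (ht : t ∈ Icc (0 : ℝ) 1) : K.left t ∈ K.carrier :=
  mem_carrier_of_toFun_eq ht (K.toFun_left t) fun h => lt_irrefl _ h.1

theorem right_mem {t : ℝ} (ht : t ∈ Icc (0 : ℝ) 1) : K.right t ∈ K.carrier := by
  refine mem_carrier_of_toFun_eq ht (K.toFun_right t) fun h => ?_
  have := h.1
  have := h.2
  simp only [mid] at this
  linarith

theorem Icc_subset_carrier {t : ℝ} (ht : t ∈ Icc (0 : ℝ) 1) (htD : t ∉ ratUnit) :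
    Icc (K.left t) (K.right t) ⊆ K.carrier := fun y hy => by
  have hyt := (K.fiber t y).2 hy
  refine mem_carrier_iff.2 ⟨hyt ▸ ht, fun d hd hyd => htD ?_⟩
  rw [← hyt, toFun_eq_of_mem_Ioo hd hyd]
  exact hd

theorem Icc_mid_subset_carrier {t : ℝ} (htD : t ∈ ratUnit) :
    Icc (K.mid t) (K.right t) ⊆ K.carrier := fun y hy => by
  refine mem_carrier_of_toFun_eq (Ioo_subset_Icc_self htD.1)
    ((K.fiber t y).2 ⟨(left_lt_mid htD).le.trans hy.1, hy.2⟩) fun h => ?_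
  exact absurd h.2 (not_lt.2 hy.1)

/-- Between two distinct values lies a rational `d`, and the deleted half of its fibre separates the
points. Hence no component meets two fibres. -/
theorem exists_notMem_between {y y' : ℝ} (hy : y ∈ K.carrier) (hy' : y' ∈ K.carrier)
    (h : K.toFun y < K.toFun y') : ∃ z, y < z ∧ z < y' ∧ z ∉ K.carrier := by
  obtain ⟨d, hd, h1, h2⟩ := exists_ratUnit_between (mem_carrier_iff.1 hy).1.1
    (mem_carrier_iff.1 hy').1.2 h
  refine ⟨K.quarter d, (K.lt_left_iff.2 h1).trans (left_lt_quarter hd), ?_, quarter_notMem hd⟩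
  exact ((quarter_lt_mid hd).trans (mid_lt_right hd)).trans (K.right_lt_iff.2 h2)

theorem exists_notMem_uIcc {y y' : ℝ} (hy : y ∈ K.carrier) (hy' : y' ∈ K.carrier)
    (h : K.toFun y' ≠ K.toFun y) : ∃ z ∈ uIcc y y', z ∉ K.carrier := by
  rcases lt_or_gt_of_ne h with h | h
  · obtain ⟨z, h1, h2, hz⟩ := exists_notMem_between hy' hy h
    exact ⟨z, mem_uIcc.2 (Or.inr ⟨h1.le, h2.le⟩), hz⟩
  · obtain ⟨z, h1, h2, hz⟩ := exists_notMem_between hy hy' h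
    exact ⟨z, mem_uIcc.2 (Or.inl ⟨h1.le, h2.le⟩), hz⟩

theorem component_of_notMem_ratUnit {t y : ℝ} (ht : t ∈ Icc (0 : ℝ) 1) (htD : t ∉ ratUnit)
    (hy : K.toFun y = t) :
    connectedComponentIn K.carrier y = Icc (K.left t) (K.right t) := by
  have hyI := (K.fiber t y).1 hy
  refine connectedComponentIn_eq_of_separated ordConnected_Icc hyI (Icc_subset_carrier ht htD)
    fun y' hy' hne => ?_
  refine exists_notMem_uIcc (Icc_subset_carrier ht htD hyI) hy' fun h => hne ?_
  exact (K.fiber t y').1 (h.trans hy)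

theorem eq_left_or_mid_le {t y : ℝ} (ht : t ∈ ratUnit) (hy : y ∈ K.carrier)
    (hyt : K.toFun y = t) : y = K.left t ∨ K.mid t ≤ y := by
  by_contra! h
  exact (mem_carrier_iff.1 hy).2 t ht
    ⟨lt_of_le_of_ne ((K.fiber _ _).1 hyt).1 h.1.symm, h.2⟩

theorem component_left {t : ℝ} (ht : t ∈ ratUnit) :
    connectedComponentIn K.carrier (K.left t) = {K.left t} := by
  have hmem : K.left t ∈ K.carrier := left_mem (Ioo_subset_Icc_self ht.1)
  refine connectedComponentIn_eq_of_separated ordConnected_singleton rfl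
    (singleton_subset_iff.2 hmem) fun y' hy' hne => ?_
  by_cases h : K.toFun y' = t
  · refine ⟨K.quarter t, mem_uIcc.2 (Or.inl ⟨(left_lt_quarter ht).le, ?_⟩), quarter_notMem ht⟩
    exact (quarter_lt_mid ht).le.trans ((eq_left_or_mid_le ht hy' h).resolve_left hne)
  · exact exists_notMem_uIcc hmem hy' (by rwa [K.toFun_left])

theorem component_of_mem_ratUnit {t y : ℝ} (ht : t ∈ ratUnit)
    (hy : y ∈ Icc (K.mid t) (K.right t)) :
    connectedComponentIn K.carrier y = Icc (K.mid t) (K.right t) := by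
  have hfy : K.toFun y = t := (K.fiber _ _).2 ⟨(left_lt_mid ht).le.trans hy.1, hy.2⟩
  refine connectedComponentIn_eq_of_separated ordConnected_Icc hy (Icc_mid_subset_carrier ht)
    fun y' hy' hne => ?_
  by_cases h : K.toFun y' = t
  · refine ⟨K.quarter t, mem_uIcc.2 (Or.inr ⟨?_, ?_⟩), quarter_notMem ht⟩
    · rcases eq_left_or_mid_le ht hy' h with rfl | h'
      · exact (left_lt_quarter ht).le
      · exact absurd ⟨h', ((K.fiber _ _).1 h).2⟩ hne
    · exact (quarter_lt_mid ht).le.trans hy.1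
  · exact exists_notMem_uIcc (Icc_mid_subset_carrier ht hy) hy' (by rwa [hfy])

theorem isClosed_carrier : IsClosed K.carrier :=
  (isClosed_Icc.preimage K.continuous).sdiff (isOpen_biUnion fun _ _ => isOpen_Ioo)

theorem carrier_subset : K.carrier ⊆ Icc (K.left 0) (K.right 1) := fun y hy => by
  have h := (mem_carrier_iff.1 hy).1
  constructor
  · by_contra! h'
    exact absurd (K.lt_left_iff.1 h') (not_lt.2 h.1)
  · by_contra! h'
    exact absurd (K.right_lt_iff.1 h') (not_lt.2 h.2)

theorem isCompact_carrier : IsCompact K.carrier :=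
  isCompact_Icc.of_isClosed_subset isClosed_carrier carrier_subset

theorem gap_Iio {x : ℝ} (hx : x < K.left 0) :
    connectedComponentIn K.carrierᶜ x = Iio (K.left 0) := by
  refine connectedComponentIn_eq_of_separated ordConnected_Iio hx
    (fun y hy h => absurd (carrier_subset h).1 (not_le.2 hy)) fun y _ hne => ?_
  refine ⟨K.left 0, mem_uIcc.2 (Or.inl ⟨hx.le, not_lt.1 hne⟩), ?_⟩
  exact not_not.2 (left_mem (left_mem_Icc.2 zero_le_one))

theorem gap_Ioi {x : ℝ} (hx : K.right 1 < x) :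
    connectedComponentIn K.carrierᶜ x = Ioi (K.right 1) := by
  refine connectedComponentIn_eq_of_separated ordConnected_Ioi hx
    (fun y hy h => absurd (carrier_subset h).2 (not_le.2 hy)) fun y _ hne => ?_
  refine ⟨K.right 1, mem_uIcc.2 (Or.inr ⟨not_lt.1 hne, hx.le⟩), ?_⟩
  exact not_not.2 (right_mem (right_mem_Icc.2 zero_le_one))

theorem gap_Ioo {d x : ℝ} (hd : d ∈ ratUnit) (hx : x ∈ Ioo (K.left d) (K.mid d)) :
    connectedComponentIn K.carrierᶜ x = Ioo (K.left d) (K.mid d) := by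
  refine connectedComponentIn_eq_of_separated ordConnected_Ioo hx
    (fun y hy h => (mem_carrier_iff.1 h).2 d hd hy) fun y _ hne => ?_
  rcases le_or_gt y (K.left d) with h | h
  · exact ⟨K.left d, mem_uIcc.2 (Or.inr ⟨h, hx.1.le⟩),
      not_not.2 (left_mem (Ioo_subset_Icc_self hd.1))⟩
  · refine ⟨K.mid d, mem_uIcc.2 (Or.inl ⟨hx.2.le, ?_⟩), not_not.2
      (Icc_mid_subset_carrier hd (left_mem_Icc.2 (mid_lt_right hd).le))⟩
    by_contra! h'
    exact hne ⟨h, h'⟩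

theorem isGap_Ioo {d : ℝ} (hd : d ∈ ratUnit) : IsGap K.carrier (Ioo (K.left d) (K.mid d)) :=
  ⟨K.quarter d, quarter_notMem hd, (gap_Ioo hd ⟨left_lt_quarter hd, quarter_lt_mid hd⟩).symm⟩

theorem isXInterval_mid {d : ℝ} (hd : d ∈ ratUnit) :
    IsXInterval K.carrier (Icc (K.mid d) (K.right d)) :=
  have h := left_mem_Icc.2 (mid_lt_right (K := K) hd).le
  ⟨⟨_, h, _, right_mem_Icc.2 (mid_lt_right hd).le, (mid_lt_right hd).ne⟩,
    K.mid d, Icc_mid_subset_carrier hd h, (component_of_mem_ratUnit hd h).symm⟩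

theorem isGap_cases {U : Set ℝ} (hU : IsGap K.carrier U) :
    U = Iio (K.left 0) ∨ U = Ioi (K.right 1) ∨ ∃ d ∈ ratUnit, U = Ioo (K.left d) (K.mid d) := by
  obtain ⟨x, hx, rfl⟩ := hU
  by_cases h0 : x < K.left 0
  · exact Or.inl (gap_Iio h0)
  by_cases h1 : K.right 1 < x
  · exact Or.inr (Or.inl (gap_Ioi h1))
  right; right
  rw [K.lt_left_iff, not_lt] at h0
  rw [K.right_lt_iff, not_lt] at h1
  have : ¬ ∀ d ∈ ratUnit, x ∉ Ioo (K.left d) (K.mid d) := fun h => hx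
    (mem_carrier_iff.2 ⟨⟨h0, h1⟩, h⟩)
  push Not at this
  obtain ⟨d, hd, hxd⟩ := this
  exact ⟨d, hd, gap_Ioo hd hxd⟩

theorem isXInterval_of_mem {t : ℝ} (ht : t = 0 ∨ t ∈ Z) :
    IsXInterval K.carrier (Icc (K.left t) (K.right t)) := by
  have hlt : K.left t < K.right t := (K.left_lt_right t).2 (ht.imp id Or.inr)
  have htI : t ∈ Icc (0 : ℝ) 1 := by
    rcases ht with rfl | ht
    · exact left_mem_Icc.2 zero_le_one
    · exact Ioo_subset_Icc_self (K.mem_Ioo t ht)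
  have htD : t ∉ ratUnit := by
    rcases ht with rfl | ht
    · exact zero_notMem_ratUnit
    · exact fun h => K.irrational t ht h.2
  exact ⟨⟨_, left_mem_Icc.2 hlt.le, _, right_mem_Icc.2 hlt.le, hlt.ne⟩,
    K.left t, left_mem htI, (component_of_notMem_ratUnit htI htD (K.toFun_left t)).symm⟩

/-- The whole fibre over each rational slightly below `t` lies in the window and contributes one gap
and one interval. -/
theorem infinite_left {t ε : ℝ} (h0 : 0 < t) (h1 : t ≤ 1) (hε : 0 < ε) :
    {J | IsXInterval K.carrier J ∧ J ⊆ Ioo (K.left t - ε) (K.left t)}.Infinite ∧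
    {V | IsGap K.carrier V ∧ V ⊆ Ioo (K.left t - ε) (K.left t)}.Infinite := by
  have hs : max 0 (K.toFun (K.left t - ε)) < t := max_lt h0 (K.lt_left_iff.1 (by linarith))
  have hinf := infinite_ratUnit_between (le_max_left _ _) h1 hs
  have hsub : ∀ d, K.toFun (K.left t - ε) < d → d < t →
      Icc (K.left d) (K.right d) ⊆ Ioo (K.left t - ε) (K.left t) := fun d h2 h3 y hy =>
    ⟨(K.lt_left_iff.2 h2).trans_le hy.1, hy.2.trans_lt (K.right_lt_left h3)⟩
  constructor
  · refine infinite_of_injOn_mapsTo (f := fun d => Icc (K.mid d) (K.right d)) ?_ ?_ hinf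
    · rintro d ⟨hd, -⟩ d' ⟨hd', -⟩ h
      have h2 : K.right d ∈ Icc (K.mid d') (K.right d') :=
        h.subset (right_mem_Icc.2 (mid_lt_right hd).le)
      have := (K.fiber d' _).2 ⟨(left_lt_mid hd').le.trans h2.1, h2.2⟩
      rwa [K.toFun_right] at this
    · rintro d ⟨hd, h2, h3⟩
      exact ⟨isXInterval_mid hd, (Icc_subset_Icc_left (left_lt_mid hd).le).trans
        (hsub d ((le_max_right _ _).trans_lt h2) h3)⟩
  · refine infinite_of_injOn_mapsTo (f := fun d => Ioo (K.left d) (K.mid d)) ?_ ?_ hinf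
    · rintro d ⟨hd, -⟩ d' ⟨hd', -⟩ h
      have h2 : K.quarter d ∈ Ioo (K.left d') (K.mid d') :=
        h.subset ⟨left_lt_quarter hd, quarter_lt_mid hd⟩
      have := toFun_eq_of_mem_Ioo hd' h2
      rwa [toFun_quarter hd] at this
    · rintro d ⟨hd, h2, h3⟩
      exact ⟨isGap_Ioo hd, (Ioo_subset_Icc_self.trans
        (Icc_subset_Icc_right (mid_lt_right hd).le)).trans
        (hsub d ((le_max_right _ _).trans_lt h2) h3)⟩

/-- The fibre over `1` must be a point for the rightmost gap to be accumulated on its left, whereas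
`0` gets an interval to serve the leftmost gap. -/
theorem left_one : K.left 1 = K.right 1 := by
  refine le_antisymm (K.left_le_right 1) (not_lt.1 fun h => ?_)
  rcases (K.left_lt_right 1).1 h with h | h | h
  · exact one_ne_zero h
  · exact lt_irrefl _ h.1.2
  · exact lt_irrefl _ (K.mem_Ioo 1 h).2

theorem isLCantorval_carrier : IsLCantorval K.carrier where
  nonempty := ⟨K.left 0, left_mem (left_mem_Icc.2 zero_le_one)⟩
  isCompact := isCompact_carrier
  adjacent_right U hU b hb := by
    rcases isGap_cases hU with rfl | rfl | ⟨d, hd, rfl⟩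
    · obtain rfl := hb.unique isLUB_Iio
      exact ⟨_, isXInterval_of_mem (Or.inl rfl), isLeast_Icc (K.left_le_right 0)⟩
    · exact absurd (⟨b, hb.1⟩ : BddAbove _) (not_bddAbove_Ioi _)
    · obtain rfl := hb.unique (isLUB_Ioo (left_lt_mid hd))
      exact ⟨_, isXInterval_mid hd, isLeast_Icc (mid_lt_right hd).le⟩
  accumulated_left U hU a ha ε hε := by
    rcases isGap_cases hU with rfl | rfl | ⟨d, hd, rfl⟩
    · exact absurd (⟨a, ha.1⟩ : BddBelow _) (not_bddBelow_Iio _)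
    · obtain rfl := ha.unique isGLB_Ioi
      rw [← left_one]
      exact infinite_left one_pos le_rfl hε
    · obtain rfl := ha.unique (isGLB_Ioo (left_lt_mid hd))
      exact infinite_left hd.1.1 hd.1.2.le hε

end IntervalCollapse

/-! ### The components without free endpoints -/

namespace IntervalCollapse

open Set Filter Topology

variable {Z : Set ℝ} {K : IntervalCollapse Z}

variable (K) in
/-- The component of the carrier over a point of `Z`. -/
def component (t : Z) : ComponentSpace K.carrier :=
  ⟨connectedComponent ⟨K.left t, left_mem (Ioo_subset_Icc_self (K.mem_Ioo t t.2))⟩, _, rfl⟩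

theorem image_component (t : Z) :
    Subtype.val '' (K.component t).1 = Icc (K.left t) (K.right t) := by
  rw [component, ← connectedComponentIn_eq_image]
  exact component_of_notMem_ratUnit (Ioo_subset_Icc_self (K.mem_Ioo t t.2))
    (fun h => K.irrational t t.2 h.2) (K.toFun_left t)

theorem mem_component_iff {t : Z} {y : K.carrier} :
    y ∈ (K.component t).1 ↔ K.toFun y = t := by
  rw [K.fiber, ← mem_Icc, ← image_component, Subtype.val_injective.mem_set_image]

theorem component_injective : Function.Injective K.component := fun t t' h => by
  have h1 : (⟨K.left t, left_mem (Ioo_subset_Icc_self (K.mem_Ioo t t.2))⟩ : K.carrier) ∈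
      (K.component t).1 := mem_component_iff.2 (K.toFun_left t)
  rw [h, mem_component_iff] at h1
  exact Subtype.ext ((K.toFun_left t).symm.trans h1)

/-- Fibres over rationals tending to `t` from below and from above accumulate at the two endpoints,
so neither is relatively interior. -/
theorem component_mem_nonFree (t : Z) : K.component t ∈ nonFreeComponents K.carrier := by
  have ht := K.mem_Ioo t t.2
  have htI : (t : ℝ) ∈ Icc (0 : ℝ) 1 := Ioo_subset_Icc_self ht
  have hlt : K.left t < K.right t := (K.left_lt_right t).2 (Or.inr (Or.inr t.2))
  have hl : (⟨K.left t, left_mem htI⟩ : K.carrier) ∈ (K.component t).1 :=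
    mem_component_iff.2 (K.toFun_left t)
  have hr : (⟨K.right t, right_mem htI⟩ : K.carrier) ∈ (K.component t).1 :=
    mem_component_iff.2 (K.toFun_right t)
  refine ⟨⟨_, hl, _, hr, fun h => hlt.ne (congrArg Subtype.val h)⟩, ?_⟩
  rintro e ⟨-, he | he, hint⟩
  · obtain rfl : e = ⟨K.left t, left_mem htI⟩ :=
      le_antisymm (he.2 hl) ((K.fiber _ _).1 (mem_component_iff.1 he.1)).1
    obtain ⟨ε, hε, hball⟩ := Metric.mem_nhds_iff.1 (mem_interior_iff_mem_nhds.1 hint)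
    have hs : max 0 (K.toFun (K.left t - ε)) < t := max_lt ht.1 (K.lt_left_iff.1 (by linarith))
    obtain ⟨d, hd, h1, h2⟩ := exists_ratUnit_between (le_max_left _ _) htI.2 hs
    have h3 := K.lt_left_iff.2 ((le_max_right _ _).trans_lt h1)
    have h4 := K.right_lt_left h2
    have hmem : (⟨K.right d, right_mem (Ioo_subset_Icc_self hd.1)⟩ : K.carrier) ∈
        (K.component t).1 := hball <| by
      rw [Metric.mem_ball, Subtype.dist_eq, Real.dist_eq, abs_lt]
      have := K.left_le_right d
      constructor <;> simp only <;> linarith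
    rw [mem_component_iff, toFun_right] at hmem
    exact h2.ne hmem
  · obtain rfl : e = ⟨K.right t, right_mem htI⟩ :=
      le_antisymm ((K.fiber _ _).1 (mem_component_iff.1 he.1)).2 (he.2 hr)
    obtain ⟨ε, hε, hball⟩ := Metric.mem_nhds_iff.1 (mem_interior_iff_mem_nhds.1 hint)
    have hs : t < min 1 (K.toFun (K.right t + ε)) :=
      lt_min ht.2 (K.right_lt_iff.1 (by linarith))
    obtain ⟨d, hd, h1, h2⟩ := exists_ratUnit_between htI.1 (min_le_left _ _) hs
    have h3 := K.right_lt_iff.2 (h2.trans_le (min_le_right _ _))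
    have h4 := K.right_lt_left h1
    have hmem : (⟨K.left d, left_mem (Ioo_subset_Icc_self hd.1)⟩ : K.carrier) ∈
        (K.component t).1 := hball <| by
      rw [Metric.mem_ball, Subtype.dist_eq, Real.dist_eq, abs_lt]
      have := K.left_le_right d
      constructor <;> simp only <;> linarith
    rw [mem_component_iff, toFun_left] at hmem
    exact h1.ne' hmem

/-- Every component not over `Z` is either a point or begins at the right end of a gap (at `mid t`
for rational `t`, or at `left 0`), which makes its left endpoint free. -/
theorem exists_component_eq {C : ComponentSpace K.carrier}
    (hC : C ∈ nonFreeComponents K.carrier) : ∃ t : Z, K.component t = C := by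
  obtain ⟨C, ⟨y, hy⟩, rfl⟩ := C
  obtain ⟨hnt, hfree⟩ := hC
  have hmem : ∀ {x : K.carrier}, x ∈ connectedComponent (⟨y, hy⟩ : K.carrier) ↔
      (x : ℝ) ∈ connectedComponentIn K.carrier y := by
    intro x
    rw [connectedComponentIn_eq_image hy, Subtype.val_injective.mem_set_image]
  obtain ⟨t, ht⟩ : ∃ t, K.toFun y = t := ⟨_, rfl⟩
  have htI : t ∈ Icc (0 : ℝ) 1 := ht ▸ (mem_carrier_iff.1 hy).1
  by_cases htD : t ∈ ratUnit
  · rcases eq_left_or_mid_le htD hy ht with rfl | hle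
    · rw [component_left htD] at hmem
      obtain ⟨a, ha, b, hb, hab⟩ := hnt
      exact absurd (Subtype.ext ((hmem.1 ha).trans (hmem.1 hb).symm)) hab
    · rw [component_of_mem_ratUnit htD ⟨hle, ((K.fiber _ _).1 ht).2⟩] at hmem
      have hm := left_mem_Icc.2 (mid_lt_right (K := K) htD).le
      refine absurd ⟨hnt, Or.inl ⟨hmem.2 hm, fun x hx => (hmem.1 hx).1⟩, ?_⟩
        (hfree ⟨K.mid t, Icc_mid_subset_carrier htD hm⟩)
      rw [mem_interior_iff_mem_nhds]
      filter_upwards [continuous_subtype_val.continuousAt.preimage_mem_nhds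
        (Ioo_mem_nhds (left_lt_mid (K := K) htD) (mid_lt_right htD))] with x hx
      refine hmem.2 ⟨?_, hx.2.le⟩
      exact (eq_left_or_mid_le htD x.2 ((K.fiber _ _).2 ⟨hx.1.le, hx.2.le⟩)).resolve_left hx.1.ne'
  · rw [component_of_notMem_ratUnit htI htD ht] at hmem
    have hlt : K.left t < K.right t := by
      obtain ⟨a, ha, b, hb, hab⟩ := hnt
      have ha := hmem.1 ha
      have hb := hmem.1 hb
      refine lt_of_le_of_ne (K.left_le_right t) fun h => hab (Subtype.ext ?_)
      rw [← h, Icc_self] at ha hb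
      exact ha.trans hb.symm
    rcases (K.left_lt_right t).1 hlt with rfl | h | h
    · refine absurd ⟨hnt, Or.inl ⟨hmem.2 (left_mem_Icc.2 hlt.le), fun x hx => (hmem.1 hx).1⟩, ?_⟩
        (hfree ⟨K.left 0, left_mem htI⟩)
      rw [mem_interior_iff_mem_nhds]
      filter_upwards [continuous_subtype_val.continuousAt.preimage_mem_nhds
        (Iio_mem_nhds hlt)] with x hx
      exact hmem.2 ⟨(carrier_subset x.2).1, le_of_lt hx⟩
    · exact absurd h htD
    · refine ⟨⟨t, h⟩, Subtype.ext (Set.ext fun x => ?_)⟩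
      rw [mem_component_iff, hmem, K.fiber]
      rfl

/-- A component fails to lie in the clopen set `V` exactly when its value is attained on `Vᶜ`; the
image of the compact set `Vᶜ` is closed. -/
theorem continuous_component : Continuous K.component := by
  refine continuous_generateFrom_iff.2 ?_
  rintro _ ⟨V, hV, rfl⟩
  have : CompactSpace K.carrier := isCompact_iff_compactSpace.1 isCompact_carrier
  have hc : IsCompact ((fun y : K.carrier => K.toFun y) '' Vᶜ) :=
    hV.isOpen.isClosed_compl.isCompact.image (K.continuous.comp continuous_subtype_val)
  convert hc.isClosed.isOpen_compl.preimage (continuous_subtype_val (p := (· ∈ Z))) using 1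
  ext t
  constructor
  · rintro h ⟨y, hy, hyt⟩
    exact hy (h (mem_component_iff.2 hyt))
  · intro h y hy
    by_contra hyV
    exact h ⟨y, hyV, mem_component_iff.1 hy⟩

theorem mem_nhds_component (t : Z) {U : Set Z} (hU : U ∈ 𝓝 t) :
    ∃ W : Set (ComponentSpace K.carrier), IsOpen W ∧ K.component t ∈ W ∧
      ∀ s, K.component s ∈ W → s ∈ U := by
  obtain ⟨N, hN, hNU⟩ := mem_nhds_induced _ _ _ |>.1 hU
  obtain ⟨a, b, ⟨ha, hb⟩, hab⟩ := mem_nhds_iff_exists_Ioo_subset.1 hN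
  have ht := K.mem_Ioo t t.2
  obtain ⟨c, hc, hc1, hc2⟩ := exists_ratUnit_between (le_max_left 0 a) ht.2.le (max_lt ht.1 ha)
  obtain ⟨d, hd, hd1, hd2⟩ := exists_ratUnit_between ht.1.le (min_le_left 1 b) (lt_min ht.2 hb)
  -- Cutting inside two gaps makes the piece between them clopen.
  let V : Set K.carrier := {y | (y : ℝ) ∈ Ioo (K.quarter c) (K.quarter d)}
  have hV : IsClopen V := by
    refine ⟨?_, isOpen_Ioo.preimage continuous_subtype_val⟩
    have : V = {y : K.carrier | (y : ℝ) ∈ Icc (K.quarter c) (K.quarter d)} := by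
      ext y
      refine ⟨fun h => Ioo_subset_Icc_self h, fun h => ⟨lt_of_le_of_ne h.1 ?_,
        lt_of_le_of_ne h.2 ?_⟩⟩
      · exact fun he => quarter_notMem hc (he ▸ y.2)
      · exact fun he => quarter_notMem hd (he ▸ y.2)
    rw [this]
    exact isClosed_Icc.preimage continuous_subtype_val
  refine ⟨{C | C.1 ⊆ V}, TopologicalSpace.isOpen_generateFrom_of_mem ⟨V, hV, rfl⟩, ?_, ?_⟩
  · intro y hy
    rw [mem_component_iff] at hy
    have h1 : K.right c < y := K.right_lt_iff.2 (hy ▸ hc2)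
    have h2 : (y : ℝ) < K.left d := K.lt_left_iff.2 (hy ▸ hd1)
    exact ⟨((quarter_lt_mid hc).trans (mid_lt_right hc)).trans h1, h2.trans (left_lt_quarter hd)⟩
  · intro s hs
    have h : K.left s ∈ Ioo (K.quarter c) (K.quarter d) :=
      hs (mem_component_iff.2 (K.toFun_left s) :
        (⟨K.left s, left_mem (Ioo_subset_Icc_self (K.mem_Ioo s s.2))⟩ : K.carrier) ∈ _)
    have h1 := K.monotone h.1.le
    have h2 := K.monotone h.2.le
    rw [toFun_left, toFun_quarter] at h1 h2
    · refine hNU (hab ⟨?_, ?_⟩)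
      · exact ((le_max_right _ _).trans_lt hc1).trans_le h1
      · exact h2.trans_lt (hd2.trans_le (min_le_right _ _))
    · exact hd
    · exact hc

variable (K) in
theorem nonempty_homeomorph : Nonempty (nonFreeComponents K.carrier ≃ₜ Z) := by
  let g : Z → nonFreeComponents K.carrier := fun t => ⟨K.component t, component_mem_nonFree t⟩
  have hg : Function.Bijective g := by
    refine ⟨fun s t h => component_injective (congrArg Subtype.val h), fun C => ?_⟩
    obtain ⟨t, ht⟩ := exists_component_eq C.2
    exact ⟨t, Subtype.ext ht⟩
  have hcont : Continuous g := continuous_component.subtype_mk _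
  have hopen : IsOpenMap g := by
    refine isOpenMap_iff_nhds_le.2 fun t S hS => ?_
    obtain ⟨W, hW, htW, hWS⟩ := mem_nhds_component t (mem_map.1 hS)
    filter_upwards [continuous_subtype_val.continuousAt.preimage_mem_nhds (hW.mem_nhds htW)]
      with C hC
    obtain ⟨s, rfl⟩ := hg.2 C
    exact hWS s hC
  exact ⟨((Equiv.ofBijective g hg).toHomeomorphOfContinuousOpen hcont hopen).symm⟩

end IntervalCollapse

/-- Every countable metrizable space is the space of components without free endpoints of some
`L`-Cantorval. -/
theorem exists_isLCantorval_homeomorph (W : Type*) [TopologicalSpace W] [Countable W]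
    [TopologicalSpace.MetrizableSpace W] :
    ∃ X : Set ℝ, IsLCantorval X ∧ Nonempty (nonFreeComponents X ≃ₜ W) := by
  obtain ⟨g, hg, hg'⟩ := exists_isEmbedding_irrational W
  obtain ⟨K⟩ := exists_intervalCollapse (Set.countable_range g) (by rintro _ ⟨w, rfl⟩; exact hg' w)
  obtain ⟨e⟩ := K.nonempty_homeomorph
  exact ⟨K.carrier, K.isLCantorval_carrier, ⟨e.trans hg.toHomeomorph.symm⟩⟩

/-! ### Invariance under homeomorphism -/

/-- A homeomorphism induces a map of component spaces. -/
def ComponentSpace.map {X Y : Type*} [TopologicalSpace X] [TopologicalSpace Y] (h : X ≃ₜ Y)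
    (C : ComponentSpace X) : ComponentSpace Y :=
  ⟨h '' C.1, by
    obtain ⟨x, hx⟩ := C.2
    refine ⟨h x, ?_⟩
    rw [hx, ← connectedComponentIn_univ, ← connectedComponentIn_univ,
      h.image_connectedComponentIn (Set.mem_univ x), Set.image_univ, h.range_coe]⟩

theorem ComponentSpace.continuous_map {X Y : Type*} [TopologicalSpace X] [TopologicalSpace Y]
    (h : X ≃ₜ Y) : Continuous (ComponentSpace.map h) := by
  refine continuous_generateFrom_iff.2 ?_
  rintro _ ⟨V, hV, rfl⟩
  refine TopologicalSpace.isOpen_generateFrom_of_mem ⟨h ⁻¹' V, hV.preimage h.continuous, ?_⟩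
  ext C
  exact Set.image_subset_iff

/-- A homeomorphism induces a homeomorphism of component spaces. -/
def ComponentSpace.congr {X Y : Type*} [TopologicalSpace X] [TopologicalSpace Y] (h : X ≃ₜ Y) :
    ComponentSpace X ≃ₜ ComponentSpace Y where
  toFun := ComponentSpace.map h
  invFun := ComponentSpace.map h.symm
  left_inv C := Subtype.ext (h.toEquiv.symm_image_image C.1)
  right_inv C := Subtype.ext (h.symm.toEquiv.symm_image_image C.1)
  continuous_toFun := ComponentSpace.continuous_map h
  continuous_invFun := ComponentSpace.continuous_map h.symm

open Set in
-- Connected sets of reals are the order-convex ones, so removing a point disconnects exactly when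
-- points remain on both sides. This frees the notion of endpoint from the order, which a
-- homeomorphism need not preserve.
theorem isLeast_or_isGreatest_iff_isPreconnected_diff {X : Set ℝ} {C : Set X}
    (hC : IsPreconnected C) {e : X} :
    IsLeast C e ∨ IsGreatest C e ↔ e ∈ C ∧ IsPreconnected (C \ {e}) := by
  rw [← Topology.IsInducing.subtypeVal.isPreconnected_image] at hC ⊢
  rw [isPreconnected_iff_ordConnected] at hC ⊢
  constructor
  · intro h
    refine ⟨h.elim (fun h => h.1) (fun h => h.1), ⟨?_⟩⟩
    rintro _ ⟨a, ⟨ha, hae⟩, rfl⟩ _ ⟨b, ⟨hb, hbe⟩, rfl⟩ x hx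
    obtain ⟨y, hy, rfl⟩ := hC.out (mem_image_of_mem _ ha) (mem_image_of_mem _ hb) hx
    refine ⟨y, ⟨hy, ?_⟩, rfl⟩
    rintro rfl
    rcases h with h | h
    · exact hae (le_antisymm hx.1 (h.2 ha))
    · exact hbe (le_antisymm (h.2 hb) hx.2)
  · rintro ⟨he, h⟩
    by_contra! hne
    obtain ⟨a, ha, hae⟩ : ∃ a ∈ C, a < e := by
      by_contra! hl
      exact hne.1 ⟨he, hl⟩
    obtain ⟨b, hb, hbe⟩ : ∃ b ∈ C, e < b := by
      by_contra! hl
      exact hne.2 ⟨he, hl⟩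
    obtain ⟨y, hy, hye⟩ := h.out (mem_image_of_mem Subtype.val ⟨ha, hae.ne⟩)
      (mem_image_of_mem Subtype.val ⟨hb, hbe.ne'⟩)
      (show (e : ℝ) ∈ Icc (a : ℝ) b from ⟨hae.le, hbe.le⟩)
    exact hy.2 (Subtype.ext hye)

theorem Function.Injective.set_nontrivial_image_iff {α β : Type*} {f : α → β}
    (hf : Function.Injective f) {s : Set α} : (f '' s).Nontrivial ↔ s.Nontrivial :=
  ⟨Set.nontrivial_of_image f s, fun h => h.image hf⟩

theorem isFreeEndpoint_image_iff {X Y : Set ℝ} (h : X ≃ₜ Y) {C : Set X} (hC : IsPreconnected C)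
    (e : X) : IsFreeEndpoint (h '' C) (h e) ↔ IsFreeEndpoint C e := by
  have hd : h '' C \ {h e} = h '' (C \ {e}) := by
    rw [Set.image_sdiff h.injective, Set.image_singleton]
  rw [IsFreeEndpoint, IsFreeEndpoint, isLeast_or_isGreatest_iff_isPreconnected_diff hC,
    isLeast_or_isGreatest_iff_isPreconnected_diff (h.isPreconnected_image.2 hC), hd,
    h.isPreconnected_image, ← h.image_interior, h.injective.mem_set_image,
    h.injective.mem_set_image, h.injective.set_nontrivial_image_iff]

theorem nonempty_homeomorph_nonFreeComponents {X Y : Set ℝ} (h : X ≃ₜ Y) :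
    Nonempty (nonFreeComponents X ≃ₜ nonFreeComponents Y) := by
  refine ⟨(ComponentSpace.congr h).subtype fun C => ?_⟩
  have hC : IsPreconnected C.1 := by
    obtain ⟨x, hx⟩ := C.2
    rw [hx]
    exact isPreconnected_connectedComponent
  refine and_congr h.injective.set_nontrivial_image_iff.symm ?_
  rw [h.surjective.forall]
  exact forall_congr' fun e => not_congr (isFreeEndpoint_image_iff h hC e).symm

/-! ### Finite Cantor-Bendixson levels and rank functions -/

section Derived

open Set Filter Topology

theorem mem_relDerivedSet_iff {T : Type*} [TopologicalSpace T] {A : Set T} {x : T} :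
    x ∈ relDerivedSet A ↔ x ∈ A ∧ ∀ U ∈ 𝓝 x, ∃ y ∈ U, y ∈ A ∧ y ≠ x := by
  simp only [relDerivedSet_apply, mem_inter_iff, mem_derivedSet, accPt_iff_nhds, and_comm,
    and_assoc]

theorem Homeomorph.image_relDerivedSet {T T' : Type*} [TopologicalSpace T] [TopologicalSpace T']
    (h : T ≃ₜ T') (A : Set T) : h '' relDerivedSet A = relDerivedSet (h '' A) := by
  ext y
  obtain ⟨x, rfl⟩ := h.surjective y
  rw [h.injective.mem_set_image, mem_relDerivedSet_iff, mem_relDerivedSet_iff,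
    h.injective.mem_set_image]
  refine and_congr_right fun _ => ⟨fun H U hU => ?_, fun H U hU => ?_⟩
  · obtain ⟨y, hyU, hyA, hyx⟩ := H _ (h.continuous.continuousAt.preimage_mem_nhds hU)
    exact ⟨h y, hyU, mem_image_of_mem _ hyA, h.injective.ne hyx⟩
  · obtain ⟨_, hyU, ⟨y, hyA, rfl⟩, hyx⟩ := H _ (h.isOpenMap.image_mem_nhds hU)
    exact ⟨y, h.injective.mem_set_image.1 hyU, hyA, fun e => hyx (e ▸ rfl)⟩

/-- The finite stages of the Cantor-Bendixson derivation of a space. -/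
def iterDerived (T : Type*) [TopologicalSpace T] (n : ℕ) : Set T :=
  relDerivedSet^[n] univ

theorem iterDerived_succ (T : Type*) [TopologicalSpace T] (n : ℕ) :
    iterDerived T (n + 1) = relDerivedSet (iterDerived T n) :=
  Function.iterate_succ_apply' _ _ _

theorem Homeomorph.image_iterDerived {T T' : Type*} [TopologicalSpace T] [TopologicalSpace T']
    (h : T ≃ₜ T') (n : ℕ) : h '' iterDerived T n = iterDerived T' n := by
  induction n with
  | zero => simp [iterDerived]
  | succ n ih => rw [iterDerived_succ, iterDerived_succ, h.image_relDerivedSet, ih]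

/-- The points of Cantor-Bendixson rank `n + 1` have a neighbourhood in which the points of rank
at least `n` form a compact set. -/
def HasCompactTrace (T : Type*) [TopologicalSpace T] (n : ℕ) : Prop :=
  ∀ x ∈ iterDerived T (n + 1), x ∉ iterDerived T (n + 2) →
    ∃ U ∈ 𝓝 x, IsCompact (U ∩ iterDerived T n)

theorem HasCompactTrace.of_homeomorph {T T' : Type*} [TopologicalSpace T] [TopologicalSpace T']
    (h : T ≃ₜ T') {n : ℕ} (H : HasCompactTrace T n) : HasCompactTrace T' n := by
  intro y hy hy'
  obtain ⟨x, rfl⟩ := h.surjective y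
  rw [← h.image_iterDerived, h.injective.mem_set_image] at hy hy'
  obtain ⟨U, hU, hc⟩ := H x hy hy'
  refine ⟨h '' U, h.isOpenMap.image_mem_nhds hU, ?_⟩
  rw [← h.image_iterDerived, ← image_inter h.injective]
  exact hc.image h.continuous

theorem IsScatteredSpace.of_homeomorph {T T' : Type*} [TopologicalSpace T] [TopologicalSpace T']
    (h : T ≃ₜ T') (H : IsScatteredSpace T) : IsScatteredSpace T' := by
  rintro B ⟨b, hb⟩
  obtain ⟨x, hx, U, hU, hUB⟩ := H (h ⁻¹' B) ⟨h.symm b, by simpa using hb⟩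
  refine ⟨h x, hx, h '' U, h.isOpenMap U hU, ?_⟩
  rw [← image_inter_preimage, hUB, image_singleton]

/-- A point of least rank in `B` is isolated in `B`. -/
theorem isScatteredSpace_of_rank {T : Type*} [TopologicalSpace T] (ρ : T → ℕ)
    (hρ : ∀ x, ∃ U ∈ 𝓝 x, ∀ y ∈ U, y ≠ x → ρ y < ρ x) : IsScatteredSpace T := by
  intro B hB
  obtain ⟨x, hx, hmin⟩ := (measure ρ).wf.has_min B hB
  obtain ⟨U, hU, hUx⟩ := hρ x
  refine ⟨x, hx, interior U, isOpen_interior, ?_⟩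
  ext y
  constructor
  · rintro ⟨hyU, hyB⟩
    by_contra hne
    exact hmin y hyB (hUx y (interior_subset hyU) hne)
  · rintro rfl
    exact ⟨mem_interior_iff_mem_nhds.2 hU, hx⟩

/-- Each derivation removes precisely the lowest remaining rank: `hlt` isolates its points, and
`hex` keeps every point of higher rank a limit of them. -/
theorem iterDerived_eq_of_rank {T : Type*} [TopologicalSpace T] (ρ : T → ℕ) {r : ℕ → ℕ}
    (hr : StrictMono r) (hρr : ∀ x, ρ x ∈ range r)
    (hlt : ∀ x, ∃ U ∈ 𝓝 x, ∀ y ∈ U, y ≠ x → ρ y < ρ x)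
    (hex : ∀ x, ∀ U ∈ 𝓝 x, ∀ i, r i < ρ x → ∃ y ∈ U, ρ y = r i) (n : ℕ) :
    iterDerived T n = {x | r n ≤ ρ x} := by
  induction n with
  | zero =>
    refine (eq_univ_of_forall fun x => ?_).symm
    obtain ⟨i, hi⟩ := hρr x
    exact (hr.monotone (Nat.zero_le i)).trans_eq hi
  | succ n ih =>
    rw [iterDerived_succ, ih]
    ext x
    rw [mem_relDerivedSet_iff]
    constructor
    · rintro ⟨-, h⟩
      obtain ⟨U, hU, hUx⟩ := hlt x
      obtain ⟨y, hyU, hy, hyx⟩ := h U hU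
      have := lt_of_le_of_lt hy (hUx y hyU hyx)
      obtain ⟨i, hi⟩ := hρr x
      rw [← hi] at this
      rw [mem_ofPred_eq, ← hi]
      exact hr.monotone (hr.lt_iff_lt.1 this)
    · intro h
      have hlt' : r n < ρ x := (hr (Nat.lt_succ_self n)).trans_le h
      refine ⟨hlt'.le, fun U hU => ?_⟩
      obtain ⟨y, hyU, hy⟩ := hex x U hU n hlt'
      exact ⟨y, hyU, hy.ge, fun e => by rw [e] at hy; exact hlt'.ne' hy⟩

/-- An ultrafilter on `K` either converges to `x` or lives on one of the finite sets `K \ V`. -/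
theorem isCompact_of_finite_diff_nhds {T : Type*} [TopologicalSpace T] {K : Set T} {x : T}
    (hx : x ∈ K) (h : ∀ V ∈ 𝓝 x, (K \ V).Finite) : IsCompact K := by
  rw [isCompact_iff_ultrafilter_le_nhds]
  intro f hf
  by_cases hfx : (f : Filter T) ≤ 𝓝 x
  · exact ⟨x, hx, hfx⟩
  · obtain ⟨V, hV, hVf⟩ := Filter.not_le.1 hfx
    have hmem : K \ V ∈ (f : Filter T) :=
      inter_mem (le_principal_iff.1 hf) (Ultrafilter.compl_mem_iff_notMem.2 hVf)
    obtain ⟨y, hy, hfy⟩ := isCompact_iff_ultrafilter_le_nhds.1 (h V hV).isCompact f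
      (le_principal_iff.2 hmem)
    exact ⟨y, hy.1, hfy⟩

end Derived

/-! ### Countable scattered spaces with prescribed ranks -/

/-- The finite sets of natural numbers, with a bound for the cardinality whose defect belongs
to `R`. -/
def FinsetRankSpace (R : Set ℕ) : Type :=
  {x : ℕ × Finset ℕ // x.2.card ≤ x.1 ∧ x.1 - x.2.card ∈ R}

/-- The pair of a number and a finite set, seen in the product of `ℕ` with the Cantor space. -/
def finsetCode (x : ℕ × Finset ℕ) : ℕ × (ℕ → Bool) := (x.1, fun k => decide (k ∈ x.2))

theorem finsetCode_injective : Function.Injective finsetCode := by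
  rintro ⟨n, s⟩ ⟨m, t⟩ h
  rw [finsetCode, finsetCode, Prod.mk.injEq] at h
  refine Prod.ext h.1 (Finset.ext fun k => ?_)
  simpa using congrFun h.2 k

namespace FinsetRankSpace

open Set Filter Topology

variable {R : Set ℕ}

instance : TopologicalSpace (FinsetRankSpace R) :=
  TopologicalSpace.induced (fun x => finsetCode x.1) inferInstance

instance : Countable (FinsetRankSpace R) :=
  inferInstanceAs (Countable {x : ℕ × Finset ℕ // x.2.card ≤ x.1 ∧ x.1 - x.2.card ∈ R})

theorem isEmbedding_code : IsEmbedding fun x : FinsetRankSpace R => finsetCode x.1 :=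
  ⟨⟨rfl⟩, finsetCode_injective.comp Subtype.val_injective⟩

instance : TopologicalSpace.MetrizableSpace (FinsetRankSpace R) :=
  isEmbedding_code.metrizableSpace

/-- The rank of a point: the defect of the cardinality. -/
def rank (x : FinsetRankSpace R) : ℕ := x.1.1 - x.1.2.card

theorem mem_nhds_iff_exists {x : FinsetRankSpace R} {U : Set (FinsetRankSpace R)} :
    U ∈ 𝓝 x ↔ ∃ N, ∀ y : FinsetRankSpace R, y.1.1 = x.1.1 →
      (∀ k < N, k ∈ y.1.2 ↔ k ∈ x.1.2) → y ∈ U := by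
  rw [isEmbedding_code.isInducing.nhds_eq_comap, mem_comap]
  constructor
  · rintro ⟨V, hV, hVU⟩
    rw [finsetCode, nhds_prod_eq, nhds_discrete, mem_prod_iff] at hV
    obtain ⟨A, hA, B, hB, hAB⟩ := hV
    obtain ⟨_, ⟨z, N, rfl⟩, hz, hzB⟩ :=
      (PiNat.isTopologicalBasis_cylinders fun _ : ℕ => Bool).mem_nhds_iff.1 hB
    refine ⟨N, fun y hy h => hVU (hAB ⟨?_, hzB ?_⟩)⟩
    · rw [show (finsetCode y.1).1 = x.1.1 from hy]
      exact hA
    · rw [← PiNat.mem_cylinder_iff_eq.1 hz, PiNat.mem_cylinder_iff]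
      intro k hk
      simpa [finsetCode] using h k hk
  · rintro ⟨N, h⟩
    refine ⟨{x.1.1} ×ˢ PiNat.cylinder (finsetCode x.1).2 N,
      prod_mem_nhds (mem_nhds_discrete.2 rfl)
        ((PiNat.isOpen_cylinder _ _ _).mem_nhds (PiNat.self_mem_cylinder _ _)), ?_⟩
    rintro y ⟨hy, hy'⟩
    refine h y hy fun k hk => ?_
    simpa [finsetCode] using PiNat.mem_cylinder_iff.1 hy' k hk

theorem exists_nhds_subset (x : FinsetRankSpace R) :
    ∃ U ∈ 𝓝 x, ∀ y ∈ U, y.1.1 = x.1.1 ∧ x.1.2 ⊆ y.1.2 := by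
  refine ⟨{y | y.1.1 = x.1.1 ∧ x.1.2 ⊆ y.1.2}, mem_nhds_iff_exists.2 ⟨x.1.2.sup id + 1,
    fun y hy h => ⟨hy, fun k hk => (h k ?_).2 hk⟩⟩, fun y hy => hy⟩
  exact Nat.lt_succ_of_le (Finset.le_sup (f := id) hk)

theorem rank_lt_of_subset {x y : FinsetRankSpace R} (h1 : y.1.1 = x.1.1) (h2 : x.1.2 ⊆ y.1.2)
    (hne : y ≠ x) : rank y < rank x := by
  have hlt : x.1.2.card < y.1.2.card := Finset.card_lt_card
    (lt_of_le_of_ne h2 fun e => hne (Subtype.ext (Prod.ext h1 e.symm)))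
  have := y.2.1
  simp only [rank]
  omega

theorem exists_nhds_rank_lt (x : FinsetRankSpace R) :
    ∃ U ∈ 𝓝 x, ∀ y ∈ U, y ≠ x → rank y < rank x := by
  obtain ⟨U, hU, h⟩ := exists_nhds_subset x
  exact ⟨U, hU, fun y hy => rank_lt_of_subset (h y hy).1 (h y hy).2⟩

theorem exists_mem_rank_eq (x : FinsetRankSpace R) {U : Set (FinsetRankSpace R)} (hU : U ∈ 𝓝 x)
    {k : ℕ} (hk : k ∈ R) (hkx : k < rank x) : ∃ y ∈ U, rank y = k := by
  obtain ⟨N, hN⟩ := mem_nhds_iff_exists.1 hU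
  -- New elements beyond `N` keep the point in `U`; beyond all members of `x.1.2` they are genuinely
  -- new, and each lowers the rank by one.
  let M := max N (x.1.2.sup id + 1)
  have hd : Disjoint x.1.2 (Finset.Ico M (M + (rank x - k))) := by
    rw [Finset.disjoint_left]
    intro a ha ha'
    have h1 : a ≤ x.1.2.sup id := Finset.le_sup (f := id) ha
    have h2 := (Finset.mem_Ico.1 ha').1
    have h3 : x.1.2.sup id + 1 ≤ M := le_max_right _ _
    omega
  have hcard : (x.1.2 ∪ Finset.Ico M (M + (rank x - k))).card = x.1.1 - k := by
    rw [Finset.card_union_of_disjoint hd, Nat.card_Ico]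
    have := x.2.1
    simp only [rank] at *
    omega
  have hk' : x.1.1 - (x.1.1 - k) = k := by
    simp only [rank] at hkx
    omega
  refine ⟨⟨(x.1.1, x.1.2 ∪ Finset.Ico M (M + (rank x - k))), ?_, ?_⟩, hN _ rfl ?_, ?_⟩
  · simp only [hcard]
    omega
  · simp only [hcard, hk']
    exact hk
  · intro a ha
    have : N ≤ M := le_max_left _ _
    simp only [Finset.mem_union, Finset.mem_Ico, or_iff_left_iff_imp]
    omega
  · exact (congrArg (x.1.1 - ·) hcard).trans hk'

/-- Near `x`, a point of rank at least `k` adds at most one element to `x.1.2`, and only finitely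
many choices of that element leave a given neighbourhood of `x`. -/
theorem exists_nhds_isCompact (x : FinsetRankSpace R) {k : ℕ} (hk : rank x = k + 1) :
    ∃ U ∈ 𝓝 x, IsCompact (U ∩ {y | k ≤ rank y}) := by
  obtain ⟨U, hU, hUx⟩ := exists_nhds_subset x
  refine ⟨U, hU, isCompact_of_finite_diff_nhds (x := x) ⟨mem_of_mem_nhds hU, by simp [hk]⟩ ?_⟩
  intro V hV
  obtain ⟨N, hN⟩ := mem_nhds_iff_exists.1 hV
  have hfin : ({x.1.1} ×ˢ ((x.1.2 ∪ Finset.range N).powerset : Finset (Finset ℕ)) :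
      Set (ℕ × Finset ℕ)).Finite := (finite_singleton _).prod (Finset.finite_toSet _)
  refine (hfin.preimage (Subtype.val_injective.injOn (s := univ) |>.mono (subset_univ _))).subset ?_
  rintro y ⟨⟨hyU, hyk⟩, hyV⟩
  obtain ⟨h1, h2⟩ := hUx y hyU
  refine ⟨h1, ?_⟩
  rw [Finset.mem_coe, Finset.mem_powerset]
  by_contra hsub
  obtain ⟨m, hm, hm'⟩ := Finset.not_subset.1 hsub
  rw [Finset.mem_union, not_or, Finset.mem_range, not_lt] at hm'
  refine hyV (hN y h1 fun a ha => ⟨fun hay => ?_, fun hax => h2 hax⟩)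
  by_contra hax
  -- Two extra elements would push the rank of `y` below `k`.
  have hsub : insert a (insert m x.1.2) ⊆ y.1.2 :=
    Finset.insert_subset hay (Finset.insert_subset hm h2)
  have hcard := Finset.card_le_card hsub
  rw [Finset.card_insert_of_notMem, Finset.card_insert_of_notMem hm'.1] at hcard
  · have hy := y.2.1
    have hyk : k ≤ rank y := hyk
    simp only [rank] at hk hyk
    omega
  · rw [Finset.mem_insert, not_or]
    exact ⟨by omega, hax⟩

/-- The sets `{N, N + 1 + j}` have defect `k` and their codes converge to that of `{N}`, whose
defect `k + 1` is forbidden. So the trace has a non-closed image in the code space. -/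
theorem not_isCompact_of_mem_nhds {k : ℕ} (hk : k ∈ R) (hk1 : k + 1 ∉ R)
    {U : Set (FinsetRankSpace R)}
    {x : FinsetRankSpace R} (hx : x.1 = (k + 2, ∅)) (hU : U ∈ 𝓝 x) :
    ¬ IsCompact (U ∩ {y | k ≤ rank y}) := by
  intro hc
  obtain ⟨N, hN⟩ := mem_nhds_iff_exists.1 hU
  rw [hx] at hN
  have hcl := (hc.image isEmbedding_code.continuous).isClosed
  have hcard : ∀ j, ({N, N + 1 + j} : Finset ℕ).card = 2 := fun j =>
    Finset.card_pair (by omega)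
  have hmem : ∀ j, finsetCode (k + 2, {N, N + 1 + j}) ∈
      (fun x : FinsetRankSpace R => finsetCode x.1) '' (U ∩ {y | k ≤ rank y}) := by
    intro j
    refine ⟨⟨(k + 2, {N, N + 1 + j}), ?_, ?_⟩, ⟨hN _ rfl fun a ha => ?_, ?_⟩, rfl⟩
    · simp only [hcard]
      omega
    · rw [hcard]
      exact hk
    · simp only [Finset.mem_insert, Finset.mem_singleton, Finset.notMem_empty, iff_false]
      omega
    · have h : k + 2 - ({N, N + 1 + j} : Finset ℕ).card = k := by
        rw [hcard, Nat.add_sub_cancel]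
      exact h.ge
  have hlim : Tendsto (fun j => finsetCode (k + 2, {N, N + 1 + j})) atTop
      (𝓝 (finsetCode (k + 2, {N}))) := by
    refine (tendsto_const_nhds (x := k + 2)).prodMk_nhds (tendsto_pi_nhds.2 fun a => ?_)
    refine tendsto_const_nhds.congr' ?_
    filter_upwards [eventually_ge_atTop a] with j hj
    simp only [Finset.mem_insert, Finset.mem_singleton, decide_eq_decide]
    omega
  obtain ⟨y, -, hy⟩ := hcl.mem_of_tendsto hlim (Eventually.of_forall hmem)
  have h := y.2.2
  rw [finsetCode_injective hy] at h
  exact hk1 (by simpa using h)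

end FinsetRankSpace

/-- The sequence of natural numbers with increments `1` and `2` prescribed by `σ`. -/
def rankSeq (σ : ℕ → Bool) : ℕ → ℕ
  | 0 => 0
  | n + 1 => rankSeq σ n + 1 + (σ n).toNat

theorem rankSeq_strictMono (σ : ℕ → Bool) : StrictMono (rankSeq σ) :=
  strictMono_nat_of_lt_succ fun n => by simp only [rankSeq]; omega

namespace FinsetRankSpace

open Set Filter Topology

theorem iterDerived_eq (σ : ℕ → Bool) (n : ℕ) :
    iterDerived (FinsetRankSpace (range (rankSeq σ))) n = {x | rankSeq σ n ≤ rank x} :=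
  iterDerived_eq_of_rank rank (rankSeq_strictMono σ) (fun x => x.2.2) exists_nhds_rank_lt
    (fun x _ hU i hi => exists_mem_rank_eq x hU (mem_range_self i) hi) n

/-- The points tested have rank exactly `rankSeq σ (n + 1)`. After an increment `1` all of them have
a compact trace; after an increment `2` the point with empty set has none. -/
theorem hasCompactTrace_iff (σ : ℕ → Bool) (n : ℕ) :
    HasCompactTrace (FinsetRankSpace (range (rankSeq σ))) n ↔ σ n = false := by
  simp only [HasCompactTrace, iterDerived_eq, mem_ofPred_eq, not_le]
  constructor
  · intro h
    by_contra hσ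
    rw [Bool.not_eq_false] at hσ
    have h2 : rankSeq σ (n + 1) = rankSeq σ n + 2 := by simp [rankSeq, hσ]
    have hk2 : (rankSeq σ n + 2) - (∅ : Finset ℕ).card ∈ range (rankSeq σ) :=
      ⟨n + 1, by simp [h2]⟩
    have hk1 : rankSeq σ n + 1 ∉ range (rankSeq σ) := by
      rintro ⟨i, hi⟩
      have h3 : n < i := (rankSeq_strictMono σ).lt_iff_lt.1 (by omega)
      have h4 := (rankSeq_strictMono σ).monotone (Nat.succ_le_of_lt h3)
      rw [Nat.succ_eq_add_one] at h4
      omega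
    obtain ⟨U, hU, hc⟩ := h ⟨(rankSeq σ n + 2, ∅), by simp, hk2⟩ (by simp [rank, h2])
      (by simpa [rank, h2] using rankSeq_strictMono σ (Nat.lt_succ_self (n + 1)))
    exact not_isCompact_of_mem_nhds (mem_range_self n) hk1 rfl hU hc
  · intro hσ x hx hx'
    obtain ⟨i, hi⟩ : rank x ∈ range (rankSeq σ) := x.2.2
    rw [← hi] at hx hx'
    have h1 := (rankSeq_strictMono σ).le_iff_le.1 hx
    have h2 := (rankSeq_strictMono σ).lt_iff_lt.1 hx'
    obtain rfl : i = n + 1 := by omega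
    exact exists_nhds_isCompact x (by rw [← hi]; simp [rankSeq, hσ])

theorem eq_of_homeomorph {σ τ : ℕ → Bool}
    (h : FinsetRankSpace (range (rankSeq σ)) ≃ₜ FinsetRankSpace (range (rankSeq τ))) :
    σ = τ := by
  funext n
  have : σ n = false ↔ τ n = false := by
    rw [← hasCompactTrace_iff, ← hasCompactTrace_iff]
    exact ⟨fun H => H.of_homeomorph h, fun H => H.of_homeomorph h.symm⟩
  cases hσ : σ n <;> cases hτ : τ n <;> simp_all

end FinsetRankSpace

theorem mainTheorem3 :
    -- continuum many pairwise non-homeomorphic `L`-Cantorvals, told apart by the invariant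
    (∃ S : Set (Set ℝ), Cardinal.mk S = Cardinal.continuum ∧
      (∀ X ∈ S, IsLCantorval X ∧
        Countable (nonFreeComponents X) ∧
        TopologicalSpace.MetrizableSpace (nonFreeComponents X) ∧
        IsScatteredSpace (nonFreeComponents X)) ∧
      ∀ X ∈ S, ∀ Y ∈ S, X ≠ Y →
        IsEmpty (X ≃ₜ Y) ∧ IsEmpty (nonFreeComponents X ≃ₜ nonFreeComponents Y)) ∧
    -- the homeomorphism type of the space of components without free endpoints is an invariant
    (∀ X Y : Set ℝ, IsLCantorval X → IsLCantorval Y →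
      Nonempty (X ≃ₜ Y) → Nonempty (nonFreeComponents X ≃ₜ nonFreeComponents Y)) ∧
    -- every subset of a countable ordinal is realised
    (∀ α : Ordinal.{0}, α.card ≤ Cardinal.aleph0 → ∀ A : Set (Set.Iio α),
      ∃ X : Set ℝ, IsLCantorval X ∧ Nonempty (nonFreeComponents X ≃ₜ A)) := by
  refine ⟨?_, fun X Y _ _ ⟨h⟩ => nonempty_homeomorph_nonFreeComponents h, fun α hα A => ?_⟩
  · choose X hX e using fun σ : ℕ → Bool =>
      exists_isLCantorval_homeomorph (FinsetRankSpace (Set.range (rankSeq σ)))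
    have hne : ∀ {σ τ}, X σ ≠ X τ →
        IsEmpty (nonFreeComponents (X σ) ≃ₜ nonFreeComponents (X τ)) := by
      intro σ τ h
      obtain ⟨f⟩ := e σ
      obtain ⟨g⟩ := e τ
      exact ⟨fun k => h (congrArg X
        (FinsetRankSpace.eq_of_homeomorph ((f.symm.trans k).trans g)))⟩
    have hinj : Function.Injective X := by
      intro σ τ h
      obtain ⟨f⟩ := e σ
      obtain ⟨g⟩ := e τ
      rw [h] at f
      exact FinsetRankSpace.eq_of_homeomorph (f.symm.trans g)
    refine ⟨Set.range X, ?_, ?_, ?_⟩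
    · rw [Cardinal.mk_range_eq X hinj]
      simp
    · rintro _ ⟨σ, rfl⟩
      obtain ⟨f⟩ := e σ
      exact ⟨hX σ, f.injective.countable, f.isEmbedding.metrizableSpace,
        (isScatteredSpace_of_rank FinsetRankSpace.rank
          FinsetRankSpace.exists_nhds_rank_lt).of_homeomorph f.symm⟩
    · rintro _ ⟨σ, rfl⟩ _ ⟨τ, rfl⟩ h
      refine ⟨⟨fun k => ?_⟩, hne h⟩
      obtain ⟨k'⟩ := nonempty_homeomorph_nonFreeComponents k
      exact (hne h).false k'
  -- Countability of the ordinal also yields metrizability of its order topology, hence of that of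
  -- `A`.
  · have : Countable (Set.Iio α) := by
      rw [← Cardinal.mk_le_aleph0_iff, Cardinal.mk_Iio_ordinal]
      exact Cardinal.lift_le_aleph0.2 hα
    exact exists_isLCantorval_homeomorph A
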